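/- Let $L$ be a countable relational language and let $\mathcal{M}$ be a countably infinite $L$-structure that is ultrahomogeneous, i.e., every isomorphism between finitely generated (equivalently, finite) substructures of $\mathcal{M}$ extends to an automorphism of $\mathcal{M}$. Let $S_L$ be the set of $L$-structures with underlying set $\mathbb{N}$, equipped with the $\sigma$-algebra generated by the sets $\{\mathcal{N} \in S_L : R^{\mathcal{N}}(n_1,\dots,n_j)\}$, where $R \in L$ is a $j$-ary relation symbol and $n_1,\dots,n_j \in \mathbb{N}$. The group $\operatorname{Sym}(\mathbb{N})$ of all permutations of $\mathbb{N}$ acts on $S_L$ by permuting the underlying set. The following are equivalent: 1. There is a probability measure $\mu$ on $S_L$ that is invariant under this action of $\operatorname{Sym}(\mathbb{N})$ and concentrated on the isomorphism class of $\mathcal{M}$, i.e., $\{\mathcal{N} \in S_L : \mathcal{N} \cong \mathcal{M}\}$ is measurable and has $\mu$-measure $1$. 2. The age of $\mathcal{M}$, i.e., the class of all finitely generated $L$-structures that are isomorphic to a substructure of $\mathcal{M}$, has the strong amalgamation property: for all $A, B, C$ in the age and all embeddings $e \colon A \to B$ and $f \colon A \to C$, there are a structure $D$ in the age and embeddings $g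 \colon B \to D$ and $h \colon C \to D$ such that $g \circ e = h \circ f$ and $g(B) \cap h(C) = (g \circ e)(A)$. -/

import Mathlib

universe u v w

open scoped FirstOrder

namespace FirstOrder.Language

/-- A class `K` of structures has the strong amalgamation property when any two embeddings
`A ↪ B`, `A ↪ C` between members of `K` can be completed to a commuting square of embeddings
into some `D ∈ K`, in such a way that the images of `B` and `C` in `D` meet exactly in the
image of `A` (so no elements outside `A` are identified). -/
def StrongAmalgamation {L : Language.{u, v}}
    (K : Set (CategoryTheory.Bundled.{w} L.Structure)) : Prop :=
  ∀ (A B C : CategoryTheory.Bundled.{w} L.Structure) (AB : A ↪[L] B) (AC : A ↪[L] C),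
    A ∈ K → B ∈ K → C ∈ K →
      ∃ (D : CategoryTheory.Bundled.{w} L.Structure) (BD : B ↪[L] D) (CD : C ↪[L] D),
        D ∈ K ∧ BD.comp AB = CD.comp AC ∧
          Set.range BD ∩ Set.range CD = Set.range (BD.comp AB)

/-- The space `S_L` of all `L`-structures with underlying set `ℕ`. -/
def StructureSpace (L : Language.{u, v}) : Type (max u v) := L.Structure ℕ

namespace StructureSpace

variable {L : Language.{u, v}}

/-- The set of `N ∈ S_L` with `R^N (x₁, …, xₙ)`. -/
def relSet {n : ℕ} (R : L.Relations n) (x : Fin n → ℕ) : Set (StructureSpace L) :=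
  {N | Structure.RelMap (self := N) R x}

/-- The set of `N ∈ S_L` with `f^N (x₁, …, xₙ) = k`; for `n = 0` these are the sets `c^N = k`
for constant symbols `c`. -/
def funSet {n : ℕ} (f : L.Functions n) (x : Fin n → ℕ) (k : ℕ) : Set (StructureSpace L) :=
  {N | Structure.funMap (self := N) f x = k}

/-- The σ-algebra on `S_L` generated by the subbasic sets. -/
instance : MeasurableSpace (StructureSpace L) :=
  MeasurableSpace.generateFrom
    ({X | ∃ (n : ℕ) (R : L.Relations n) (x : Fin n → ℕ), X = relSet R x} ∪
      {X | ∃ (n : ℕ) (f : L.Functions n) (x : Fin n → ℕ) (k : ℕ), X = funSet f x k})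

/-- The logic action of the permutations of `ℕ` on `S_L`: `g • N` is the structure obtained from
`N` by transport along `g`, so that `R^(g • N) (x) ↔ R^N (g⁻¹ x)` and
`f^(g • N) (x) = g (f^N (g⁻¹ x))`. -/
instance : MulAction (Equiv.Perm ℕ) (StructureSpace L) where
  smul g N := { funMap := fun f x => g (Structure.funMap (self := N) f (g.symm ∘ x))
                RelMap := fun R x => Structure.RelMap (self := N) R (g.symm ∘ x) }
  one_smul _ := rfl
  mul_smul _ _ _ := rfl

/-- The set of all `N ∈ S_L` that are isomorphic to `M`. -/
def isoClass (L : Language.{u, v}) (M : Type w) [L.Structure M] : Set (StructureSpace L) :=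
  {N | Nonempty (@Language.Equiv L ℕ M N _)}

end StructureSpace

/-- A measure is concentrated on a set `X` when `X` is measurable and has measure one. -/
def IsConcentratedOn {Ω : Type w} [MeasurableSpace Ω] (μ : MeasureTheory.Measure Ω)
    (X : Set Ω) : Prop :=
  MeasurableSet X ∧ μ X = 1

/-- `M` admits an invariant measure: some probability measure on `S_L` is invariant under the
logic action and concentrated on the isomorphism class of `M`. -/
def AdmitsInvariantMeasure (L : Language.{u, v}) (M : Type w) [L.Structure M] : Prop :=
  ∃ μ : MeasureTheory.Measure (StructureSpace L),
    MeasureTheory.IsProbabilityMeasure μ ∧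
    MeasureTheory.SMulInvariantMeasure (Equiv.Perm ℕ) (StructureSpace L) μ ∧
    IsConcentratedOn μ (StructureSpace.isoClass L M)

end FirstOrder.Language

/-! From measure to amalgamation: some finite partial map `f` onto `F ∪ B` is a partial isomorphism
with positive probability. Permutations that fix the labels of `F` and send those of `B` to pairwise
disjoint places give events of equal probability, so infinitely many of them hold in a single copy
of `M`. Ultrahomogeneity turns these into automorphisms, and comparing two of them gives one that
fixes `F` and pushes `B` off a given finite set (`AdmitsInvariantMeasure.exists_equiv`). Pushing one
of two embedded structures off the other yields a strong amalgam.

From amalgamation to measure: strong amalgamation gives `HasTrivialClosure`, hence growing finite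
sets `F n` in which any part can be moved to twins by an automorphism. A real number codes a
trajectory that at each time stays or moves to its twin. Trajectories of distinct reals eventually
separate, and from then on finite tuples of them move by automorphisms, so their limiting relations
are those of a tuple in `M`. Independent samples from an atomless law give an exchangeable structure
on `ℕ`. It is almost surely isomorphic to `M` by back-and-forth (`backAndForth_eventualStructure`),
since the `F n` contain extension witnesses and trajectories are born at every point of them. -/

namespace FirstOrder.Language

/-! ### Partial isomorphisms, back-and-forth, and measurability of the isomorphism class. -/

section PartialIsomorphisms

variable {L : Language.{u, v}} {M : Type w} [L.Structure M]

/-- A finite relation between `ℕ` and `M` which is the graph of an injective partial map that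
preserves and reflects all the relation symbols of `L`. -/
def IsPartialIso (N : StructureSpace L) (f : Finset (ℕ × M)) : Prop :=
  (∀ p ∈ f, ∀ q ∈ f, p.1 = q.1 ↔ p.2 = q.2) ∧
    ∀ (n : ℕ) (R : L.Relations n) (x : Fin n → ℕ) (y : Fin n → M), (∀ i, (x i, y i) ∈ f) →
      (Structure.RelMap (self := N) R x ↔ Structure.RelMap R y)

open Classical in
/-- The back-and-forth conditions between `N` and `M`. -/
def BackAndForth (M : Type w) [L.Structure M] (N : StructureSpace L) : Prop :=
  IsPartialIso N (∅ : Finset (ℕ × M)) ∧ ∀ f : Finset (ℕ × M), IsPartialIso N f →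
    (∀ j, ∃ b, IsPartialIso N (insert (j, b) f)) ∧ (∀ b, ∃ j, IsPartialIso N (insert (j, b) f))

/-- In an ultrahomogeneous relational structure, an injective relation-preserving map on a
finite set is the restriction of an automorphism. -/
theorem IsUltrahomogeneous.exists_equiv [L.IsRelational] (hM : L.IsUltrahomogeneous M)
    (F : Finset M) (φ : M → M) (hinj : Set.InjOn φ F)
    (hrel : ∀ (n : ℕ) (R : L.Relations n) (y : Fin n → M), (∀ i, y i ∈ F) →
      (Structure.RelMap R (φ ∘ y) ↔ Structure.RelMap R y)) :
    ∃ g : M ≃[L] M, ∀ x ∈ F, g x = φ x := by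
  have hmem : ∀ x, x ∈ Substructure.closure L (F : Set M) ↔ x ∈ F := fun x => by
    rw [Substructure.mem_closure_iff_of_isRelational]; simp
  let e : Substructure.closure L (F : Set M) ↪[L] M :=
    { toFun := fun x => φ x
      inj' := fun x y h => Subtype.ext (hinj ((hmem _).1 x.2) ((hmem _).1 y.2) h)
      map_fun' := fun {n} f => isEmptyElim f
      map_rel' := fun {n} R x => by
        exact hrel n R (fun i => (x i : M)) fun i => (hmem _).1 (x i).2 }
  obtain ⟨g, hg⟩ := hM _ (Substructure.fg_closure F.finite_toSet) e
  refine ⟨g, fun x hx => ?_⟩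
  have := DFunLike.congr_fun hg ⟨x, (hmem x).2 hx⟩
  exact this.symm

/-- If `e` is injective and relation-preserving on a set `F` containing the domain of a partial
isomorphism `f`, then `f` composed with some automorphism agrees with `e`. -/
theorem IsPartialIso.exists_equiv [L.IsRelational] (hM : L.IsUltrahomogeneous M)
    {N : StructureSpace L} {f : Finset (ℕ × M)} (hf : IsPartialIso N f) (F : Finset ℕ)
    (hF : ∀ p ∈ f, p.1 ∈ F)
    (e : ℕ → M) (he : Set.InjOn e F) (hrel : ∀ (n : ℕ) (R : L.Relations n) (x : Fin n → ℕ),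
      (∀ i, x i ∈ F) →
      (Structure.RelMap (self := N) R x ↔ Structure.RelMap R (e ∘ x))) :
    ∃ g : M ≃[L] M, ∀ p ∈ f, g p.2 = e p.1 := by
  classical
  -- The inverse of `f`, with a junk value off its range; `e ∘ idx` is then a finite partial
  -- isomorphism of `M`, which extends.
  let idx : M → ℕ := fun a => if h : ∃ i, (i, a) ∈ f then h.choose else 0
  have hidx : ∀ p ∈ f, idx p.2 = p.1 := fun p hp => by
    have h : ∃ i, (i, p.2) ∈ f := ⟨p.1, hp⟩
    simp only [idx, dif_pos h]
    exact (hf.1 _ h.choose_spec p hp).2 rfl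
  obtain ⟨g, hg⟩ := hM.exists_equiv (f.image Prod.snd) (e ∘ idx) (by
      intro a ha b hb hab
      simp only [Finset.coe_image, Set.mem_image, Finset.mem_coe] at ha hb
      obtain ⟨p, hp, rfl⟩ := ha
      obtain ⟨q, hq, rfl⟩ := hb
      simp only [Function.comp, hidx p hp, hidx q hq] at hab
      exact (hf.1 p hp q hq).1 (he (hF p hp) (hF q hq) hab)) (by
      intro n R y hy
      have hy' : ∀ i, (idx (y i), y i) ∈ f := fun i => by
        obtain ⟨p, hp, hpi⟩ := Finset.mem_image.1 (hy i)
        rw [← hpi, hidx p hp]; exact hp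
      rw [← hf.2 n R (idx ∘ y) y hy', Function.comp_assoc,
        hrel n R (idx ∘ y) fun i => hF _ (hy' i)])
  refine ⟨g, fun p hp => ?_⟩
  rw [hg p.2 (Finset.mem_image_of_mem _ hp), Function.comp, hidx p hp]

/-- A finite relation that agrees, up to an automorphism, with an injective relation-preserving map
is a partial isomorphism. -/
theorem isPartialIso_of_equiv {N : StructureSpace L} {f : Finset (ℕ × M)}
    (e : ℕ → M) (F : Set ℕ) (hF : ∀ p ∈ f, p.1 ∈ F)
    (he : Set.InjOn e F) (hrel : ∀ (n : ℕ) (R : L.Relations n) (x : Fin n → ℕ), (∀ i, x i ∈ F) →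
      (Structure.RelMap (self := N) R x ↔ Structure.RelMap R (e ∘ x)))
    (g : M ≃[L] M) (hg : ∀ p ∈ f, g p.2 = e p.1) : IsPartialIso N f := by
  refine ⟨fun p hp q hq => ?_, fun n R x y h => ?_⟩
  · rw [← g.injective.eq_iff, hg p hp, hg q hq]
    exact (he.eq_iff (hF p hp) (hF q hq)).symm
  · rw [hrel n R x fun i => hF _ (h i), ← g.map_rel R y]
    have : e ∘ x = g ∘ y := funext fun i => (hg _ (h i)).symm
    rw [this]

theorem mem_isoClass_iff {N : StructureSpace L} [L.IsRelational] :
    N ∈ StructureSpace.isoClass L M ↔ ∃ e : ℕ ≃ M, ∀ (n : ℕ) (R : L.Relations n)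
      (x : Fin n → ℕ), Structure.RelMap (self := N) R x ↔ Structure.RelMap R (e ∘ x) := by
  constructor
  · rintro ⟨e⟩
    exact ⟨@Language.Equiv.toEquiv L _ _ N _ e, fun n R x =>
      (@Language.Equiv.map_rel' L _ _ N _ e n R x).symm⟩
  · rintro ⟨e, he⟩
    let _ : L.Structure ℕ := N
    exact ⟨{ toEquiv := e
             map_fun' := fun {n} f => isEmptyElim f
             map_rel' := fun {n} R x => (he n R x).symm }⟩

theorem BackAndForth.mem_isoClass [L.IsRelational] [Countable M] {N : StructureSpace L}
    (h : BackAndForth M N) : N ∈ StructureSpace.isoClass L M := by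
  classical
  obtain ⟨h0, hstep⟩ := h
  let P := {f : Finset (ℕ × M) // IsPartialIso N f}
  -- There are countably many requirements, one for each point of either side, so some ideal of
  -- partial isomorphisms meets them all; its union is the isomorphism.
  let C : ℕ ⊕ M → Order.Cofinal P := fun s => s.elim
    (fun j => ⟨{f | ∃ b, (j, b) ∈ f.1}, fun f => by
      obtain ⟨b, hb⟩ := (hstep f.1 f.2).1 j
      exact ⟨⟨_, hb⟩, ⟨b, Finset.mem_insert_self _ _⟩, Finset.subset_insert _ _⟩⟩)
    (fun b => ⟨{f | ∃ j, (j, b) ∈ f.1}, fun f => by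
      obtain ⟨j, hj⟩ := (hstep f.1 f.2).2 b
      exact ⟨⟨_, hj⟩, ⟨j, Finset.mem_insert_self _ _⟩, Finset.subset_insert _ _⟩⟩)
  have : Encodable M := Encodable.ofCountable M
  let I := Order.idealOfCofinals (⟨∅, h0⟩ : P) C
  have hdir : ∀ f ∈ I, ∀ g ∈ I, ∃ k ∈ I, f ≤ k ∧ g ≤ k := fun f hf g hg => I.directed f hf g hg
  have hl : ∀ j, ∃ b, ∃ f ∈ I, (j, b) ∈ f.1 := fun j => by
    obtain ⟨f, ⟨b, hb⟩, hf⟩ := Order.cofinal_meets_idealOfCofinals (⟨∅, h0⟩ : P) C (Sum.inl j)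
    exact ⟨b, f, hf, hb⟩
  have hr : ∀ b, ∃ j, ∃ f ∈ I, (j, b) ∈ f.1 := fun b => by
    obtain ⟨f, ⟨j, hj⟩, hf⟩ := Order.cofinal_meets_idealOfCofinals (⟨∅, h0⟩ : P) C (Sum.inr b)
    exact ⟨j, f, hf, hj⟩
  have key : ∀ p, (∃ f ∈ I, p ∈ f.1) → ∀ q, (∃ f ∈ I, q ∈ f.1) → (p.1 = q.1 ↔ p.2 = q.2) := by
    rintro p ⟨f, hf, hp⟩ q ⟨g, hg, hq⟩
    obtain ⟨k, -, hfk, hgk⟩ := hdir f hf g hg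
    exact k.2.1 p (hfk hp) q (hgk hq)
  choose e he using hl
  choose e' he' using hr
  have hfin : ∀ s : Finset ℕ, ∃ k ∈ I, ∀ j ∈ s, (j, e j) ∈ k.1 := by
    intro s
    induction s using Finset.induction_on with
    | empty =>
      obtain ⟨f, hf⟩ := I.nonempty
      exact ⟨f, hf, by simp⟩
    | insert j s _ ih =>
      obtain ⟨k, hk, hks⟩ := ih
      obtain ⟨f, hf, hj⟩ := he j
      obtain ⟨k', hk', h1, h2⟩ := hdir f hf k hk
      refine ⟨k', hk', fun i hi => ?_⟩
      rcases Finset.mem_insert.1 hi with rfl | hi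
      exacts [h1 hj, h2 (hks i hi)]
  rw [mem_isoClass_iff]
  refine ⟨⟨e, e', fun j => (key _ (he' (e j)) _ (he j)).2 rfl,
    fun b => (key _ (he (e' b)) _ (he' b)).1 rfl⟩, fun n R x => ?_⟩
  obtain ⟨k, -, hk⟩ := hfin (Finset.univ.image x)
  exact k.2.2 n R x _ fun i => hk _ (Finset.mem_image_of_mem _ (Finset.mem_univ i))

theorem backAndForth_of_mem_isoClass [L.IsRelational] (hM : L.IsUltrahomogeneous M)
    {N : StructureSpace L} (h : N ∈ StructureSpace.isoClass L M) : BackAndForth M N := by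
  classical
  obtain ⟨e, he⟩ := mem_isoClass_iff.1 h
  refine ⟨⟨by simp, fun n R x y h => ?_⟩, fun f hf => ?_⟩
  -- Only nullary relation symbols matter for the empty map.
  · rw [he n R x]
    have : e ∘ x = y := funext fun i => absurd (h i) (by simp)
    rw [this]
  obtain ⟨g, hg⟩ := hf.exists_equiv hM (f.image Prod.fst)
    (fun p hp => Finset.mem_image_of_mem _ hp) e e.injective.injOn fun n R x _ => he n R x
  have main : ∀ j b, g b = e j → IsPartialIso N (insert (j, b) f) := fun j b hjb => by
    refine isPartialIso_of_equiv e Set.univ (fun _ _ => trivial) e.injective.injOn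
      (fun n R x _ => he n R x) g fun p hp => ?_
    rcases Finset.mem_insert.1 hp with rfl | hp
    exacts [hjb, hg p hp]
  exact ⟨fun j => ⟨g.symm (e j), main _ _ (by simp)⟩,
    fun b => ⟨e.symm (g b), main _ _ (by simp)⟩⟩

theorem measurableSet_isPartialIso [Countable M] [Countable L.Symbols] (f : Finset (ℕ × M)) :
    MeasurableSet {N : StructureSpace L | IsPartialIso N f} := by
  have : ∀ n, Countable (L.Relations n) := fun n => by
    have : Function.Injective (fun R : L.Relations n => (Sum.inr ⟨n, R⟩ : L.Symbols)) := by
      intro a b hab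
      simpa using hab
    exact this.countable
  have : {N : StructureSpace L | IsPartialIso N f} =
      {_N : StructureSpace L | ∀ p ∈ f, ∀ q ∈ f, p.1 = q.1 ↔ p.2 = q.2} ∩
      ⋂ (n : ℕ), ⋂ (R : L.Relations n), ⋂ (x : Fin n → ℕ), ⋂ (y : Fin n → M),
        ⋂ (_ : ∀ i, (x i, y i) ∈ f),
          {N : StructureSpace L | Structure.RelMap (self := N) R x ↔ Structure.RelMap R y} := by
    ext N
    simp only [IsPartialIso, Set.mem_ofPred_eq, Set.mem_inter_iff, Set.mem_iInter]
  rw [this]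
  refine (MeasurableSet.const _).inter (.iInter fun n => .iInter fun R => .iInter fun x =>
    .iInter fun y => .iInter fun _ => ?_)
  have hR : MeasurableSet (StructureSpace.relSet R x) :=
    MeasurableSpace.measurableSet_generateFrom (Or.inl ⟨n, R, x, rfl⟩)
  by_cases hy : Structure.RelMap R y
  · simp only [hy, iff_true]; exact hR
  · simp only [hy, iff_false]; exact hR.compl

/-- By ultrahomogeneity the class is cut out by back-and-forth over finite partial maps, which
involves only countable unions and intersections. -/
theorem measurableSet_isoClass [L.IsRelational] [Countable L.Symbols] [Countable M]
    (hM : L.IsUltrahomogeneous M) : MeasurableSet (StructureSpace.isoClass L M) := by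
  classical
  have : StructureSpace.isoClass L M = {N : StructureSpace L | BackAndForth M N} :=
    Set.ext fun N => ⟨backAndForth_of_mem_isoClass hM, fun h => h.mem_isoClass⟩
  rw [this]
  refine (measurableSet_isPartialIso _).inter ?_
  have : {N : StructureSpace L | ∀ f : Finset (ℕ × M), IsPartialIso N f →
      (∀ j, ∃ b, IsPartialIso N (insert (j, b) f)) ∧
        (∀ b, ∃ j, IsPartialIso N (insert (j, b) f))} =
      ⋂ f : Finset (ℕ × M), ({N | IsPartialIso N f}ᶜ ∪
        ((⋂ j : ℕ, ⋃ b : M, {N | IsPartialIso N (insert (j, b) f)}) ∩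
          ⋂ b : M, ⋃ j : ℕ, {N | IsPartialIso N (insert (j, b) f)})) := by
    ext N
    simp only [Set.mem_ofPred_eq, Set.mem_iInter, Set.mem_union, Set.mem_compl_iff,
      Set.mem_inter_iff, Set.mem_iUnion, imp_iff_not_or]
  change MeasurableSet {N : StructureSpace L | ∀ f : Finset (ℕ × M), IsPartialIso N f → _}
  rw [this]
  exact .iInter fun f => (measurableSet_isPartialIso f).compl.union
    ((MeasurableSet.iInter fun j => .iUnion fun b => measurableSet_isPartialIso _).inter
      (.iInter fun b => .iUnion fun j => measurableSet_isPartialIso _))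

end PartialIsomorphisms

/-! ### Strong amalgamation, trivial closure and twins. -/

section Homogeneity

variable {L : Language.{u, v}} {M : Type w} [L.Structure M]

/-- Every element outside a finite set `F` can be moved off any finite set by an automorphism
fixing `F` pointwise. -/
def HasTrivialClosure (L : Language.{u, v}) (M : Type w) [L.Structure M] : Prop :=
  ∀ (F D : Finset M) (b : M), b ∉ F → ∃ g : M ≃[L] M, (∀ x ∈ F, g x = x) ∧ g b ∉ D

/-- Amalgamate `F ∪ {b}` with `F ∪ D` over `F` inside `M`. Ultrahomogeneity realizes the two
embeddings by `g₂` and `g₁`, and `g₁⁻¹ ∘ g₂` works because the images meet only in that of `F`. -/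
theorem StrongAmalgamation.hasTrivialClosure [L.IsRelational] (hM : L.IsUltrahomogeneous M)
    (h : StrongAmalgamation (L.age M)) : HasTrivialClosure L M := by
  classical
  intro F D b hb
  let A := Substructure.closure L (F : Set M)
  let B := Substructure.closure L (insert b F : Set M)
  let C := Substructure.closure L (F ∪ D : Set M)
  have hAB : A ≤ B := (Substructure.closure L).monotone (Set.subset_insert _ _)
  have hAC : A ≤ C := (Substructure.closure L).monotone Set.subset_union_left
  have hAfg : A.FG := Substructure.fg_closure F.finite_toSet
  have hBfg : B.FG := Substructure.fg_closure (F.finite_toSet.insert _)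
  have hCfg : C.FG := Substructure.fg_closure (F.finite_toSet.union D.finite_toSet)
  obtain ⟨E, BE, CE, ⟨-, ⟨k⟩⟩, hcomm, hint⟩ := h (.of A) (.of B) (.of C)
    (Substructure.inclusion hAB) (Substructure.inclusion hAC)
    (age.fg_substructure hAfg) (age.fg_substructure hBfg) (age.fg_substructure hCfg)
  obtain ⟨g₁, hg₁⟩ := hM C hCfg (k.comp CE)
  obtain ⟨g₂, hg₂⟩ := hM B hBfg (k.comp BE)
  have h₁ : ∀ x : C, g₁ x = k (CE x) := fun x => (DFunLike.congr_fun hg₁ x).symm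
  have h₂ : ∀ x : B, g₂ x = k (BE x) := fun x => (DFunLike.congr_fun hg₂ x).symm
  refine ⟨g₁.symm.comp g₂, fun x hx => ?_, fun hD => ?_⟩
  · have hxA : x ∈ A := Substructure.subset_closure hx
    have e : BE ⟨x, hAB hxA⟩ = CE ⟨x, hAC hxA⟩ := DFunLike.congr_fun hcomm ⟨x, hxA⟩
    have e' : g₂ x = g₁ x := by
      rw [h₂ ⟨x, hAB hxA⟩, h₁ ⟨x, hAC hxA⟩, e]
    rw [Equiv.comp_apply, e', Equiv.symm_apply_apply]
  · set c := (g₁.symm.comp g₂) b with hc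
    have hbB : b ∈ B := Substructure.subset_closure (Set.mem_insert _ _)
    have hcC : c ∈ C := Substructure.subset_closure (Or.inr hD)
    have e : g₁ c = g₂ b := by rw [hc, Equiv.comp_apply, Equiv.apply_symm_apply]
    rw [h₁ ⟨c, hcC⟩, h₂ ⟨b, hbB⟩] at e
    have hmem : BE ⟨b, hbB⟩ ∈ Set.range BE ∩ Set.range CE :=
      ⟨⟨_, rfl⟩, ⟨⟨c, hcC⟩, k.injective e⟩⟩
    rw [hint] at hmem
    obtain ⟨⟨a, haA⟩, ha⟩ := hmem
    have ha' : a = b := congrArg Subtype.val (BE.injective ha)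
    have : b ∈ A := ha' ▸ haA
    rw [Substructure.mem_closure_iff_of_isRelational] at this
    exact hb this

/-- Embed `B` and `C` into `M` so that they agree on `A`, then push the rest of `B` off `C`; the two
images together generate the amalgam. -/
theorem strongAmalgamation_of_exists_equiv [L.IsRelational] (hM : L.IsUltrahomogeneous M)
    (h : ∀ F B C : Finset M, Disjoint F B →
      ∃ g : M ≃[L] M, (∀ x ∈ F, g x = x) ∧ ∀ b ∈ B, g b ∉ C) :
    StrongAmalgamation (L.age M) := by
  classical
  rintro A B C AB AC ⟨hAfg, -⟩ ⟨hBfg, ⟨iB⟩⟩ ⟨hCfg, ⟨iC⟩⟩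
  have hA : Finite A := Structure.FG.finite hAfg
  have hB : Finite B := Structure.FG.finite hBfg
  have hC : Finite C := Structure.FG.finite hCfg
  have := Fintype.ofFinite A
  have := Fintype.ofFinite B
  have := Fintype.ofFinite C
  have : Nonempty (B ↪[L] M) := ⟨iB⟩
  obtain ⟨iB, hiB⟩ := hM.extend_embedding hAfg (iC.comp AC) AB
  have hiB' : ∀ a, iC (AC a) = iB (AB a) := fun a => DFunLike.congr_fun hiB a
  let F : Finset M := Finset.univ.image fun a => iB (AB a)
  obtain ⟨g, hgF, hg⟩ := h F (Finset.univ.image iB \ F) (Finset.univ.image iC)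
    Finset.disjoint_sdiff
  let jB : B ↪[L] M := g.toEmbedding.comp iB
  have hjB : ∀ b, jB b = g (iB b) := fun _ => rfl
  have hjA : ∀ a, jB (AB a) = iC (AC a) := fun a => by
    rw [hjB, hgF _ (Finset.mem_image_of_mem _ (Finset.mem_univ a)), hiB']
  let S : L.Substructure M := Substructure.closure L (Set.range jB ∪ Set.range iC)
  have hS : S.FG := Substructure.fg_closure ((Set.finite_range _).union (Set.finite_range _))
  have hBS : ∀ b, jB b ∈ S := fun b => Substructure.subset_closure (Or.inl ⟨b, rfl⟩)
  have hCS : ∀ c, iC c ∈ S := fun c => Substructure.subset_closure (Or.inr ⟨c, rfl⟩)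
  refine ⟨.of S, jB.codRestrict S hBS, iC.codRestrict S hCS, age.fg_substructure hS, ?_, ?_⟩
  · ext a
    exact Subtype.ext (hjA a)
  · apply Set.Subset.antisymm
    · rintro _ ⟨⟨b, rfl⟩, ⟨c, hc⟩⟩
      have hc' : iC c = g (iB b) := congrArg Subtype.val hc
      by_cases hb : iB b ∈ F
      · obtain ⟨a, -, ha⟩ := Finset.mem_image.1 hb
        exact ⟨a, congrArg (jB.codRestrict S hBS) (iB.injective ha)⟩
      · refine absurd ?_ (hg (iB b) (Finset.mem_sdiff.2
          ⟨Finset.mem_image_of_mem _ (Finset.mem_univ b), hb⟩))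
        rw [← hc']
        exact Finset.mem_image_of_mem _ (Finset.mem_univ c)
    · rintro _ ⟨a, rfl⟩
      exact ⟨⟨AB a, rfl⟩, ⟨AC a, Subtype.ext (hjA a).symm⟩⟩

open Classical in
/-- A finite set can be doubled: each point `x` of `F` gets a twin `c x ≠ x`, and replacing any
of the points by their twins is realized by an automorphism. -/
theorem HasTrivialClosure.exists_twins (h : HasTrivialClosure L M) (F : Finset M) :
    ∃ c : M → M, (∀ x ∈ F, c x ≠ x) ∧
      ∀ S : Set M, ∃ g : M ≃[L] M, ∀ x ∈ F, g x = if x ∈ S then c x else x := by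
  -- Twins are placed outside all of `F`, so that none of them equals the next point `b` to be
  -- twinned.
  suffices H : ∀ K ⊆ F, ∃ c : M → M, (∀ x ∈ K, c x ∉ F) ∧
      ∀ S ⊆ (K : Set M), ∃ g : M ≃[L] M, ∀ x ∈ F, g x = if x ∈ S then c x else x by
    obtain ⟨c, hc, hS⟩ := H F subset_rfl
    refine ⟨c, fun x hx hcx => hc x hx (by rwa [hcx]), fun S => ?_⟩
    obtain ⟨g, hg⟩ := hS (S ∩ F) Set.inter_subset_right
    exact ⟨g, fun x hx => by rw [hg x hx]; simp [hx]⟩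
  intro K
  induction K using Finset.induction_on with
  | empty =>
    intro _
    refine ⟨id, by simp, fun S _ => ⟨Equiv.refl L M, fun x _ => by simp⟩⟩
  | insert b K hbK ih =>
    intro hK
    obtain ⟨c, hc, hS⟩ := ih ((Finset.subset_insert _ _).trans hK)
    have hbF : b ∈ F := hK (Finset.mem_insert_self _ _)
    -- As `k` fixes the other points and the twins already chosen, applying it after `g` changes
    -- only the image of `b`.
    obtain ⟨k, hk, hkb⟩ := h (F.erase b ∪ K.image c) F b (by
      intro hb
      rcases Finset.mem_union.1 hb with hb | hb
      · simp at hb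
      · obtain ⟨x, hx, rfl⟩ := Finset.mem_image.1 hb
        exact hc x hx hbF)
    have hne : ∀ x ∈ K, x ≠ b := fun x hx hxb => hbK (hxb ▸ hx)
    refine ⟨Function.update c b (k b), fun x hx => ?_, fun S hSK => ?_⟩
    · rcases Finset.mem_insert.1 hx with rfl | hx
      · simpa using hkb
      · rw [Function.update_of_ne (hne x hx)]
        exact hc x hx
    · obtain ⟨g, hg⟩ := hS (S ∩ K) Set.inter_subset_right
      have hSx : ∀ x ∈ S, x ≠ b → x ∈ K := fun x hx hxb => by
        have := hSK hx
        simp only [Finset.coe_insert, Set.mem_insert_iff, Finset.mem_coe] at this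
        exact this.resolve_left hxb
      have hg' : ∀ x ∈ F, x ≠ b → g x = if x ∈ S then c x else x := fun x hx hxb => by
        rw [hg x hx]
        by_cases hxS : x ∈ S
        · simp [hxS, hSx x hxS hxb]
        · simp [hxS]
      have hgb : g b = b := by rw [hg b hbF]; simp [hbK]
      by_cases hbS : b ∈ S
      · refine ⟨k.comp g, fun x hx => ?_⟩
        rw [Equiv.comp_apply]
        by_cases hxb : x = b
        · subst hxb
          rw [hgb]; simp [hbS]
        · rw [hg' x hx hxb, Function.update_of_ne hxb]
          split_ifs with hxS
          · exact hk _ (Finset.mem_union_right _ (Finset.mem_image_of_mem _ (hSx x hxS hxb)))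
          · exact hk _ (Finset.mem_union_left _ (Finset.mem_erase.2 ⟨hxb, hx⟩))
      · refine ⟨g, fun x hx => ?_⟩
        by_cases hxb : x = b
        · subst hxb
          rw [hgb]; simp [hbS]
        · rw [hg' x hx hxb, Function.update_of_ne hxb]

/-- A finite set of witnesses for all the ways of mapping parts of `D` into `E` by
automorphisms. -/
theorem exists_finset_witnesses (L : Language.{u, v}) [L.Structure M] (E D : Finset M) :
    ∃ W : Finset M, ∀ (A : Set M) (g : M ≃[L] M), A ⊆ D → (∀ a ∈ A, g a ∈ E) →
      ∃ g' : M ≃[L] M, (∀ a ∈ A, g' a = g a) ∧ ∀ x ∈ D, g' x ∈ W := by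
  classical
  -- The pattern of those values of `g` on `D` that fall in `E`. There are finitely many patterns,
  -- and one automorphism for each suffices.
  let φ : (M ≃[L] M) → D → Option E := fun g x => if h : g x ∈ E then some ⟨g x, h⟩ else none
  let ψ : Set.range φ → (M ≃[L] M) := fun p => p.2.choose
  have hψ : ∀ p, φ (ψ p) = p := fun p => p.2.choose_spec
  have : Fintype (Set.range φ) := Fintype.ofFinite _
  refine ⟨Finset.univ.biUnion fun p => D.image (ψ p), fun A g hA hg => ?_⟩
  refine ⟨ψ ⟨φ g, g, rfl⟩, fun a ha => ?_, fun x hx => ?_⟩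
  · have := congrFun (hψ ⟨φ g, g, rfl⟩) ⟨a, hA ha⟩
    simp only [φ, dif_pos (hg a ha)] at this
    split_ifs at this with h
    simpa using this
  · exact Finset.mem_biUnion.2 ⟨_, Finset.mem_univ _, Finset.mem_image_of_mem _ hx⟩

end Homogeneity

/-! ### From an invariant measure to automorphisms. -/

section InvariantMeasure

open MeasureTheory Filter

variable {L : Language.{u, v}} {M : Type w} [L.Structure M]

open Classical in
theorem isPartialIso_smul_image (g : _root_.Equiv.Perm ℕ) (N : StructureSpace L)
    (f : Finset (ℕ × M)) :
    IsPartialIso (g • N) (f.image fun p => (g p.1, p.2)) ↔ IsPartialIso N f := by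
  simp only [IsPartialIso, Finset.forall_mem_image, EmbeddingLike.apply_eq_iff_eq]
  refine and_congr Iff.rfl (forall_congr' fun n => forall_congr' fun R => ?_)
  have key : ∀ (x : Fin n → ℕ) (y : Fin n → M),
      (∀ i, (x i, y i) ∈ f.image fun p => (g p.1, p.2)) ↔ ∀ i, ((g.symm ∘ x) i, y i) ∈ f := by
    refine fun x y => forall_congr' fun i => ?_
    simp only [Finset.mem_image, Prod.mk.injEq, Prod.exists, Function.comp]
    constructor
    · rintro ⟨a, b, hab, h1, rfl⟩
      rw [← h1]; simpa using hab
    · intro h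
      exact ⟨_, _, h, by simp, rfl⟩
  constructor
  · intro h x y hxy
    have := h (g ∘ x) y ((key _ _).2 fun i => by simpa using hxy i)
    rw [← this]
    have hx : g.symm ∘ g ∘ x = x := by ext i; simp
    exact iff_of_eq (congrArg _ hx.symm)
  · intro h x y hxy
    exact h _ y ((key x y).1 hxy)

/-- Infinitely many permutations of `ℕ` that fix `s` pointwise and move `t` to pairwise disjoint
sets. -/
theorem exists_perm_disjoint (s t : Finset ℕ) (h : Disjoint s t) :
    ∃ σ : ℕ → _root_.Equiv.Perm ℕ, (∀ k, ∀ i ∈ s, σ k i = i) ∧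
      ∀ i ∈ t, ∀ j ∈ t, ∀ k l, σ k i = σ l j → k = l := by
  classical
  obtain ⟨K, hK⟩ : ∃ K, ∀ i ∈ s ∪ t, i < K :=
    ⟨(s ∪ t).sup id + 1, fun i hi => Nat.lt_succ_of_le (Finset.le_sup (f := id) hi)⟩
  have hs : ∀ i ∈ s, i < K := fun i hi => hK i (Finset.mem_union_left _ hi)
  have ht : ∀ i ∈ t, i < K := fun i hi => hK i (Finset.mem_union_right _ hi)
  have hle : ∀ k : ℕ, K ≤ (k + 1) * K := fun k => Nat.le_mul_of_pos_left _ k.succ_pos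
  -- The involution exchanging `t` with its translate by `(k + 1) * K`. Since `K` bounds `s ∪ t`,
  -- the translates avoid `s ∪ t` and one another.
  let φ : ℕ → ℕ → ℕ := fun k i => if i ∈ t then i + (k + 1) * K else
    if (k + 1) * K ≤ i ∧ i - (k + 1) * K ∈ t then i - (k + 1) * K else i
  have hφ : ∀ k, Function.Involutive (φ k) := fun k i => by
    have hk := hle k
    by_cases hi : i ∈ t
    · have h1 : i + (k + 1) * K ∉ t := fun h' => by have := ht _ h'; omega
      simp [φ, hi, h1]
    · by_cases hi' : (k + 1) * K ≤ i ∧ i - (k + 1) * K ∈ t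
      · simp only [φ, hi, if_false, if_pos hi', if_pos hi'.2]
        omega
      · simp [φ, hi, if_neg hi']
  refine ⟨fun k => (hφ k).toPerm, fun k i hi => ?_, fun i hi j hj k l hkl => ?_⟩
  · have hi' : i ∉ t := Finset.disjoint_left.1 h hi
    have h2 : ¬ (k + 1) * K ≤ i := by have := hs i hi; have := hle k; omega
    simp [φ, hi', h2]
  · simp only [Function.Involutive.coe_toPerm, φ, if_pos hi, if_pos hj] at hkl
    have h1 := ht i hi
    have h2 := ht j hj
    by_contra hne
    rcases Nat.lt_or_gt_of_ne hne with hlt | hlt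
    · have : (k + 2) * K ≤ (l + 1) * K := Nat.mul_le_mul_right _ (by omega)
      rw [show (k + 2) * K = (k + 1) * K + K by ring] at this
      omega
    · have : (l + 2) * K ≤ (k + 1) * K := Nat.mul_le_mul_right _ (by omega)
      rw [show (l + 2) * K = (l + 1) * K + K by ring] at this
      omega

/-- If infinitely many events have the same positive probability, then with positive probability
infinitely many of them occur. -/
theorem measure_frequently_ne_zero {Ω : Type*} [MeasurableSpace Ω] {μ : Measure Ω}
    [IsFiniteMeasure μ] {A : ℕ → Set Ω} (hA : ∀ k, MeasurableSet (A k)) {p : ENNReal}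
    (hp : p ≠ 0) (h : ∀ k, μ (A k) = p) : μ {ω | ∃ᶠ k in atTop, ω ∈ A k} ≠ 0 := by
  have hset : {ω | ∃ᶠ k in atTop, ω ∈ A k} = ⋂ n : ℕ, ⋃ k ≥ n, A k := by
    ext ω
    simp [frequently_atTop]
  have hanti : Antitone fun n : ℕ => ⋃ k ≥ n, A k := fun m n hmn =>
    Set.iUnion₂_mono' fun k hk => ⟨k, le_trans hmn hk, subset_rfl⟩
  have ht := tendsto_measure_iInter_atTop (μ := μ) (s := fun n : ℕ => ⋃ k ≥ n, A k)
    (fun n => (MeasurableSet.iUnion fun k => .iUnion fun _ => hA k).nullMeasurableSet) hanti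
    ⟨0, measure_ne_top _ _⟩
  rw [hset]
  -- Each tail union has measure at least `p`; continuity from above passes this to the limit
  -- superior.
  have hle : p ≤ μ (⋂ n : ℕ, ⋃ k ≥ n, A k) := by
    refine ge_of_tendsto' ht fun n => ?_
    rw [← h n]
    exact measure_mono (Set.subset_iUnion₂_of_subset n le_rfl subset_rfl)
  exact fun h0 => hp (le_antisymm (hle.trans h0.le) zero_le)

theorem AdmitsInvariantMeasure.exists_equiv [L.IsRelational] [Countable L.Symbols] [Countable M]
    (hM : L.IsUltrahomogeneous M) (h : AdmitsInvariantMeasure L M)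
    (F B C : Finset M) (hFB : Disjoint F B) :
    ∃ g : M ≃[L] M, (∀ x ∈ F, g x = x) ∧ ∀ b ∈ B, g b ∉ C := by
  classical
  obtain ⟨μ, hμ, hinv, hmeas, hone⟩ := h
  -- a partial isomorphism onto `F ∪ B` that has positive probability
  obtain ⟨f, hf, hf0⟩ : ∃ f : Finset (ℕ × M), f.image Prod.snd = F ∪ B ∧
      μ {N | IsPartialIso N f} ≠ 0 := by
    by_contra! hcon
    have hcov : StructureSpace.isoClass L M ⊆
        ⋃ f ∈ {f : Finset (ℕ × M) | f.image Prod.snd = F ∪ B},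
          {N : StructureSpace L | IsPartialIso N f} := by
      intro N hN
      obtain ⟨e, he⟩ := mem_isoClass_iff.1 hN
      refine Set.mem_iUnion₂.2 ⟨(F ∪ B).image fun a => (e.symm a, a), ?_, ?_⟩
      · simp [Finset.image_image, Function.comp_def]
      · refine isPartialIso_of_equiv e Set.univ (fun _ _ => trivial) e.injective.injOn
          (fun n R x _ => he n R x) (Equiv.refl L M) fun p hp => ?_
        obtain ⟨a, -, rfl⟩ := Finset.mem_image.1 hp
        simp
    have h0 : μ (StructureSpace.isoClass L M) = 0 := measure_mono_null hcov <|
      (measure_biUnion_null_iff (Set.to_countable _)).2 fun f hf => hcon f hf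
    rw [h0] at hone
    exact zero_ne_one hone
  obtain ⟨N₀, hN₀⟩ := nonempty_of_measure_ne_zero hf0
  have hfun : ∀ p ∈ f, ∀ q ∈ f, p.1 = q.1 ↔ p.2 = q.2 := hN₀.1
  -- The labels of `F` stay fixed while those of `B` move to infinitely many disjoint places.
  obtain ⟨σ, hσs, hσt⟩ := exists_perm_disjoint ((f.filter (·.2 ∈ F)).image Prod.fst)
    ((f.filter (·.2 ∈ B)).image Prod.fst) (by
      rw [Finset.disjoint_left]
      intro i hi hi'
      obtain ⟨p, hp, rfl⟩ := Finset.mem_image.1 hi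
      obtain ⟨q, hq, hpq⟩ := Finset.mem_image.1 hi'
      rw [Finset.mem_filter] at hp hq
      have := (hfun q hq.1 p hp.1).1 hpq
      exact Finset.disjoint_left.1 hFB hp.2 (this ▸ hq.2))
  let A : ℕ → Set (StructureSpace L) := fun k =>
    {N | IsPartialIso N (f.image fun p => (σ k p.1, p.2))}
  have hAμ : ∀ k, μ (A k) = μ {N | IsPartialIso N f} := fun k => by
    rw [← hinv.measure_preimage_smul (σ k) (measurableSet_isPartialIso _)]
    congr 1
    ext N
    exact isPartialIso_smul_image (σ k) N f
  have hfreq := measure_frequently_ne_zero (fun k => measurableSet_isPartialIso _) hf0 hAμ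
  obtain ⟨N, hNA, hN⟩ : ({N | ∃ᶠ k in atTop, N ∈ A k} ∩ StructureSpace.isoClass L M).Nonempty := by
    have hae : StructureSpace.isoClass L M ∈ ae μ := (prob_compl_eq_zero_iff hmeas).2 hone
    refine nonempty_of_measure_ne_zero (μ := μ) ?_
    rwa [measure_inter_conull hae]
  obtain ⟨e, he⟩ := mem_isoClass_iff.1 hN
  have hext : ∀ k, N ∈ A k → ∃ g : M ≃[L] M, ∀ p ∈ f, g p.2 = e (σ k p.1) := fun k hk => by
    obtain ⟨g, hg⟩ := IsPartialIso.exists_equiv hM hk _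
      (fun p hp => Finset.mem_image_of_mem Prod.fst hp) e e.injective.injOn fun n R x _ => he n R x
    exact ⟨g, fun p hp => hg (σ k p.1, p.2) (Finset.mem_image_of_mem _ hp)⟩
  obtain ⟨k₀, hk₀⟩ := hNA.exists
  obtain ⟨g₀, hg₀⟩ := hext k₀ hk₀
  -- only finitely many copies of `B` meet the finite set `g₀ C`
  have hfin : {k | ∃ p ∈ f, p.2 ∈ B ∧ e (σ k p.1) ∈ C.image g₀}.Finite := by
    have hsub : {k | ∃ p ∈ f, p.2 ∈ B ∧ e (σ k p.1) ∈ C.image g₀} ⊆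
        ⋃ c ∈ C, {k | ∃ p ∈ f, p.2 ∈ B ∧ e (σ k p.1) = g₀ c} := by
      rintro k ⟨p, hp, hpB, hpC⟩
      obtain ⟨c, hc, hpc⟩ := Finset.mem_image.1 hpC
      exact Set.mem_iUnion₂.2 ⟨c, hc, p, hp, hpB, hpc.symm⟩
    refine Set.Finite.subset (C.finite_toSet.biUnion fun c _ => Set.Subsingleton.finite ?_) hsub
    rintro k ⟨p, hp, hpB, hpc⟩ l ⟨q, hq, hqB, hqc⟩
    exact hσt p.1 (Finset.mem_image_of_mem _ (Finset.mem_filter.2 ⟨hp, hpB⟩)) q.1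
      (Finset.mem_image_of_mem _ (Finset.mem_filter.2 ⟨hq, hqB⟩)) k l
      (e.injective (hpc.trans hqc.symm))
  obtain ⟨k, hkA, hk⟩ := ((hNA.and_eventually (by
    rw [← Nat.cofinite_eq_atTop]; exact hfin.compl_mem_cofinite))).exists
  obtain ⟨g, hg⟩ := hext k hkA
  have hmem : ∀ a ∈ F ∪ B, ∃ i, (i, a) ∈ f := fun a ha => by
    rw [← hf] at ha
    obtain ⟨p, hp, rfl⟩ := Finset.mem_image.1 ha
    exact ⟨p.1, hp⟩
  -- Both `g₀` and `g` send a point of `F` to the `e`-image of its unmoved label, so they agree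
  -- there; `g b ∈ g₀ C` is excluded by the choice of `k`.
  refine ⟨g₀.symm.comp g, fun x hx => ?_, fun b hb hbC => hk ?_⟩
  · obtain ⟨i, hi⟩ := hmem x (Finset.mem_union_left _ hx)
    have hi' : i ∈ (f.filter (·.2 ∈ F)).image Prod.fst :=
      Finset.mem_image.2 ⟨_, Finset.mem_filter.2 ⟨hi, hx⟩, rfl⟩
    have e1 := hg _ hi
    have e2 := hg₀ _ hi
    simp only [hσs _ i hi'] at e1 e2
    rw [Equiv.comp_apply, e1, ← e2, Equiv.symm_apply_apply]
  · obtain ⟨i, hi⟩ := hmem b (Finset.mem_union_right _ hb)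
    refine ⟨(i, b), hi, hb, Finset.mem_image.2 ⟨_, hbC, ?_⟩⟩
    rw [Equiv.comp_apply, Equiv.apply_symm_apply, hg _ hi]

end InvariantMeasure

/-! ### Splitting sequences, trajectories and the limiting structure. -/

section SplittingSequence

open Filter

variable {L : Language.{u, v}} {M : Type w} [L.Structure M]

/-- An increasing sequence of finite sets `F n` with twin maps `C n : F n → F (n + 1)`, such that
`F (n + 1)` contains witnesses for extensions, by the first `n` terms of the enumeration `d`, of
finite maps into the doubling of `F n`. -/
structure IsSplittingSequence (L : Language.{u, v}) {M : Type w} [L.Structure M] (d : ℕ → M)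
    (F : ℕ → Finset M) (C : ℕ → M → M) : Prop where
  start_mem : ∀ n, d 0 ∈ F n
  mem_succ : ∀ n, ∀ x ∈ F n, x ∈ F (n + 1)
  twin_mem_succ : ∀ n, ∀ x ∈ F n, C n x ∈ F (n + 1)
  twin_ne : ∀ n, ∀ x ∈ F n, C n x ≠ x
  -- This lets each point move or stay independently of the others without changing any relation
  -- among them.
  exists_equiv : ∀ n, ∀ (S : Set M) [DecidablePred (· ∈ S)],
    ∃ g : M ≃[L] M, ∀ x ∈ F n, g x = if x ∈ S then C n x else x
  exists_witness : ∀ n, ∀ (A : Set M) (g : M ≃[L] M), (∀ a ∈ A, ∃ i ≤ n, d i = a) →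
    (∀ a ∈ A, ∃ x ∈ F n, g a = x ∨ g a = C n x) →
    ∃ g' : M ≃[L] M, (∀ a ∈ A, g' a = g a) ∧ ∀ i ≤ n, g' (d i) ∈ F (n + 1)

theorem HasTrivialClosure.exists_isSplittingSequence (h : HasTrivialClosure L M) (d : ℕ → M) :
    ∃ F C, IsSplittingSequence L d F C := by
  classical
  choose c hc hS using h.exists_twins
  choose W hW using fun (E : Finset M) (n : ℕ) =>
    exists_finset_witnesses L E ((Finset.range (n + 1)).image d)
  -- Witnesses are taken over the doubled set, because a point of `F n` may sit at its twin at time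
  -- `n + 1`.
  let F : ℕ → Finset M := fun n => Nat.rec {d 0}
    (fun n F => (F ∪ F.image (c F)) ∪ W (F ∪ F.image (c F)) n) n
  have hF : ∀ n, F (n + 1) = (F n ∪ (F n).image (c (F n))) ∪
    W (F n ∪ (F n).image (c (F n))) n := fun n => rfl
  have hmono : ∀ n, ∀ x ∈ F n, x ∈ F (n + 1) := fun n x hx => by
    rw [hF]; exact Finset.mem_union_left _ (Finset.mem_union_left _ hx)
  refine ⟨F, fun n => c (F n), fun n => ?_, hmono, fun n x hx => ?_, fun n => hc _,
    fun n S _ => ?_, fun n A g hA hg => ?_⟩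
  · induction n with
    | zero => exact Finset.mem_singleton_self _
    | succ n ih => exact hmono _ _ ih
  · rw [hF]
    exact Finset.mem_union_left _ (Finset.mem_union_right _ (Finset.mem_image_of_mem _ hx))
  · obtain ⟨g, hg⟩ := hS (F n) S
    exact ⟨g, fun x hx => by rw [hg x hx]; congr⟩
  · obtain ⟨g', h1, h2⟩ := hW (F n ∪ (F n).image (c (F n))) n A g (fun a ha => by
      obtain ⟨i, hi, rfl⟩ := hA a ha
      exact Finset.mem_coe.2 (Finset.mem_image_of_mem _ (Finset.mem_range.2 (by omega))))
      (fun a ha => by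
        obtain ⟨x, hx, hx' | hx'⟩ := hg a ha
        · rw [hx']; exact Finset.mem_union_left _ hx
        · rw [hx']; exact Finset.mem_union_right _ (Finset.mem_image_of_mem _ hx))
    refine ⟨g', h1, fun i hi => ?_⟩
    rw [hF]
    exact Finset.mem_union_right _
      (h2 _ (Finset.mem_image_of_mem _ (Finset.mem_range.2 (by omega))))

/-- The time from which on the trajectory of the parameter `z` moves. -/
noncomputable def birth (z : ℝ) : ℕ := (Nat.unpair ⌊z⌋₊).1

open Classical in
/-- The trajectory in `M` that is coded by a real number `z`: the integer part of `z` determines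
a time `birth z` and the value at that time; from then on the trajectory moves at time `n` to its
twin when `z < q n`. -/
noncomputable def trajectory (d : ℕ → M) (F : ℕ → Finset M) (C : ℕ → M → M) (q : ℕ → ℝ)
    (z : ℝ) : ℕ → M
  -- The default `d 0` belongs to every `F n` of a splitting sequence, so the trajectory is in `F
  -- (birth z)` at birth in either case.
  | 0 => if d (Nat.unpair ⌊z⌋₊).2 ∈ F (birth z) then d (Nat.unpair ⌊z⌋₊).2 else d 0
  | n + 1 => if birth z ≤ n ∧ z < q n then C n (trajectory d F C q z n)
      else trajectory d F C q z n

/-- The structure on `ℕ` in which a relation holds if it eventually holds along the sequences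
`X i`. -/
def eventualStructure (L : Language.{u, v}) [L.IsRelational] [L.Structure M] (X : ℕ → ℕ → M) :
    StructureSpace L :=
  { funMap := fun f _ => isEmptyElim f
    RelMap := fun R x => ∀ᶠ n in atTop, Structure.RelMap R fun i => X (x i) n }

/-- Automorphisms preserve relations, so truth values along the tuple are constant from time `n` on.
-/
theorem eventualStructure_relMap_iff [L.IsRelational] {X : ℕ → ℕ → M} {s : Finset ℕ} {n : ℕ}
    (h : ∀ m ≥ n, ∃ g : M ≃[L] M, ∀ i ∈ s, g (X i n) = X i m)
    {k : ℕ} (R : L.Relations k) (x : Fin k → ℕ) (hx : ∀ i, x i ∈ s) :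
    Structure.RelMap (self := eventualStructure L X) R x ↔
      Structure.RelMap R ((X · n) ∘ x) := by
  have key : ∀ m ≥ n, (Structure.RelMap R (fun i => X (x i) m) ↔
      Structure.RelMap R ((X · n) ∘ x)) := fun m hm => by
    obtain ⟨g, hg⟩ := h m hm
    rw [← g.map_rel R ((X · n) ∘ x)]
    have : (fun i => X (x i) m) = g ∘ (X · n) ∘ x := funext fun i => (hg _ (hx i)).symm
    rw [this]
  change (∀ᶠ m in atTop, Structure.RelMap R fun i => X (x i) m) ↔ _
  constructor
  · intro hev
    obtain ⟨m, hm, hmn⟩ := (hev.and (eventually_ge_atTop n)).exists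
    exact (key m hmn).1 hm
  · intro hR
    filter_upwards [eventually_ge_atTop n] with m hm
    exact (key m hm).2 hR

variable {d : ℕ → M} {F : ℕ → Finset M} {C : ℕ → M → M} {q : ℕ → ℝ}

theorem trajectory_succ (z : ℝ) (n : ℕ) [Decidable (birth z ≤ n ∧ z < q n)] :
    trajectory d F C q z (n + 1) = if birth z ≤ n ∧ z < q n then C n (trajectory d F C q z n)
      else trajectory d F C q z n := by
  rw [trajectory]; congr

theorem trajectory_of_le_birth (z : ℝ) {n : ℕ} (hn : n ≤ birth z) :
    trajectory d F C q z n = trajectory d F C q z 0 := by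
  classical
  induction n with
  | zero => rfl
  | succ n ih => rw [trajectory_succ, if_neg (by omega), ih (by omega)]

theorem trajectory_birth (z : ℝ) (h : d (Nat.unpair ⌊z⌋₊).2 ∈ F (birth z)) :
    trajectory d F C q z (birth z) = d (Nat.unpair ⌊z⌋₊).2 := by
  rw [trajectory_of_le_birth z le_rfl, trajectory, if_pos h]

namespace IsSplittingSequence

variable (hFC : IsSplittingSequence L d F C)
include hFC

theorem trajectory_mem (z : ℝ) {n : ℕ} (hn : birth z ≤ n) :
    trajectory d F C q z n ∈ F n := by
  classical
  induction n, hn using Nat.le_induction with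
  | base =>
    rw [trajectory_of_le_birth z le_rfl, trajectory]
    split_ifs with h
    exacts [h, hFC.start_mem _]
  | succ n hn ih =>
    rw [trajectory_succ]
    split_ifs
    exacts [hFC.twin_mem_succ _ _ ih, hFC.mem_succ _ _ ih]

variable (q) in
theorem exists_equiv_trajectory {s : Finset ℝ} {n : ℕ} (hs : ∀ z ∈ s, birth z ≤ n)
    (hinj : Set.InjOn (trajectory d F C q · n) s) {m : ℕ} (hm : n ≤ m) :
    ∃ g : M ≃[L] M, ∀ z ∈ s, g (trajectory d F C q z n) = trajectory d F C q z m := by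
  classical
  induction m, hm using Nat.le_induction with
  | base => exact ⟨Equiv.refl L M, fun _ _ => rfl⟩
  | succ m hm ih =>
    obtain ⟨g, hg⟩ := ih
    have hinj' : ∀ z ∈ s, ∀ z' ∈ s, trajectory d F C q z m = trajectory d F C q z' m → z = z' :=
      fun z hz z' hz' h => by
        rw [← hg z hz, ← hg z' hz'] at h
        exact hinj hz hz' (g.injective h)
    -- Positions at time `m` are still distinct, so each determines its parameter and hence whether
    -- it moves; one automorphism performs all the moves.
    obtain ⟨k, hk⟩ := hFC.exists_equiv m
      {x | ∃ z ∈ s, trajectory d F C q z m = x ∧ birth z ≤ m ∧ z < q m}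
    refine ⟨k.comp g, fun z hz => ?_⟩
    have hb := (hs z hz).trans hm
    rw [Equiv.comp_apply, hg z hz, hk _ (hFC.trajectory_mem z hb), trajectory_succ]
    split_ifs with h1 h2 h2
    · rfl
    · obtain ⟨z', hz', he, h⟩ := h1
      exact absurd (hinj' _ hz' _ hz he ▸ h) h2
    · exact absurd ⟨z, hz, rfl, h2⟩ h1
    · rfl

/-- When `q n` separates the two reals, only the smaller one moves to its twin, so coinciding
trajectories split. Once distinct after both births, they remain so, being carried along by
automorphisms. -/
theorem eventually_trajectory_ne (hq : ∀ a b : ℝ, a < b → ∃ᶠ n in atTop, a < q n ∧ q n ≤ b)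
    {z z' : ℝ} (h : z ≠ z') :
    ∀ᶠ n in atTop, trajectory d F C q z n ≠ trajectory d F C q z' n := by
  classical
  wlog hlt : z < z' generalizing z z'
  · filter_upwards [this h.symm (lt_of_le_of_ne (not_lt.1 hlt) h.symm)] with n hn using hn.symm
  obtain ⟨n, ⟨hqz, hqz'⟩, hn⟩ := ((hq z z' hlt).and_eventually
    ((eventually_ge_atTop (birth z)).and (eventually_ge_atTop (birth z')))).exists
  have hstep : trajectory d F C q z (n + 1) ≠ trajectory d F C q z' (n + 1) ∨
      trajectory d F C q z n ≠ trajectory d F C q z' n := by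
    by_contra! hcon
    rw [trajectory_succ, trajectory_succ, if_pos ⟨hn.1, hqz⟩, if_neg (by
      rintro ⟨-, h'⟩; exact absurd hqz' (not_le.2 h')), ← hcon.2] at hcon
    exact hFC.twin_ne n _ (hFC.trajectory_mem z hn.1) hcon.1
  have hgo : ∀ m ≥ n, trajectory d F C q z m ≠ trajectory d F C q z' m →
      ∀ᶠ k in atTop, trajectory d F C q z k ≠ trajectory d F C q z' k := by
    intro m hm hne
    filter_upwards [eventually_ge_atTop m] with k hk heq
    obtain ⟨g, hg⟩ := hFC.exists_equiv_trajectory q (s := {z, z'}) (n := m) (by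
      intro y hy
      rcases Finset.mem_insert.1 hy with rfl | hy
      · exact hn.1.trans hm
      · rw [Finset.mem_singleton.1 hy]; exact hn.2.trans hm) (by
      intro y hy y' hy' he
      simp only [Finset.coe_insert, Finset.coe_singleton, Set.mem_insert_iff,
        Set.mem_singleton_iff] at hy hy'
      rcases hy with rfl | rfl <;> rcases hy' with rfl | rfl
      exacts [rfl, absurd he hne, absurd he.symm hne, rfl]) hk
    exact hne (g.injective (by rw [hg z (by simp), hg z' (by simp), heq]))
  rcases hstep with h1 | h1
  exacts [hgo _ (by omega) h1, hgo _ le_rfl h1]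

/-- The structure given by the trajectories of distinct reals, among which every integer part
occurs infinitely often, satisfies the back-and-forth conditions. -/
theorem backAndForth_eventualStructure [L.IsRelational] (hM : L.IsUltrahomogeneous M)
    (hd : Function.Surjective d)
    (hq : ∀ a b : ℝ, a < b → ∃ᶠ n in atTop, a < q n ∧ q n ≤ b) {ω : ℕ → ℝ}
    (hinj : Function.Injective ω) (hω : ∀ k, ∃ᶠ i in atTop, ⌊ω i⌋₊ = k) :
    BackAndForth M (eventualStructure L fun i => trajectory d F C q (ω i)) := by
  classical
  set X : ℕ → ℕ → M := fun i => trajectory d F C q (ω i) with hX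
  -- the condition under which the tuple indexed by `s` does not change its type any more
  let Settled : Finset ℕ → ℕ → Prop := fun s n =>
    (∀ i ∈ s, birth (ω i) ≤ n) ∧ Set.InjOn (X · n) s
  have hset : ∀ s, ∀ᶠ n in atTop, Settled s n := fun s => by
    have h1 : ∀ᶠ n in atTop, ∀ i ∈ s, birth (ω i) ≤ n :=
      (eventually_all_finset s).2 fun i _ => eventually_ge_atTop _
    have h2 : ∀ᶠ n in atTop, ∀ i ∈ s, ∀ j ∈ s, i ≠ j → X i n ≠ X j n :=
      (eventually_all_finset s).2 fun i _ => (eventually_all_finset s).2 fun j _ => by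
        by_cases hij : i = j
        · simp [hij]
        · filter_upwards [hFC.eventually_trajectory_ne hq (hinj.ne hij)] with n hn _ using hn
    filter_upwards [h1, h2] with n h1 h2
    exact ⟨h1, fun i hi j hj hij => by_contra fun hne => h2 i hi j hj hne hij⟩
  have hequiv : ∀ s n, Settled s n → ∀ m ≥ n, ∃ g : M ≃[L] M, ∀ i ∈ s, g (X i n) = X i m := by
    rintro s n ⟨h1, h2⟩ m hm
    obtain ⟨g, hg⟩ := hFC.exists_equiv_trajectory q (s := s.image ω) (n := n)
      (by simpa using h1) (by
        rintro _ hz _ hz' he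
        simp only [Finset.coe_image, Set.mem_image, Finset.mem_coe] at hz hz'
        obtain ⟨i, hi, rfl⟩ := hz
        obtain ⟨j, hj, rfl⟩ := hz'
        rw [h2 hi hj he]) hm
    exact ⟨g, fun i hi => hg _ (Finset.mem_image_of_mem _ hi)⟩
  have hrel : ∀ s n, Settled s n → ∀ (k : ℕ) (R : L.Relations k) (x : Fin k → ℕ),
      (∀ i, x i ∈ s) → (Structure.RelMap (self := eventualStructure L X) R x ↔
        Structure.RelMap R ((X · n) ∘ x)) := fun s n h k R x hx =>
    eventualStructure_relMap_iff (hequiv s n h) R x hx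
  have hpart : ∀ (f : Finset (ℕ × M)) (s : Finset ℕ) (n : ℕ), Settled s n → (∀ p ∈ f, p.1 ∈ s) →
      ∀ g : M ≃[L] M, (∀ p ∈ f, g p.2 = X p.1 n) → IsPartialIso (eventualStructure L X) f :=
    fun f s n h hf g hg => isPartialIso_of_equiv (X · n) s hf h.2 (hrel s n h) g hg
  refine ⟨?_, fun f hf => ⟨fun j => ?_, fun b => ?_⟩⟩
  · obtain ⟨n, hn⟩ := (hset ∅).exists
    exact hpart ∅ ∅ n hn (by simp) (Equiv.refl L M) (by simp)
  · obtain ⟨n, hn⟩ := (hset (insert j (f.image Prod.fst))).exists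
    have hfs : ∀ p ∈ f, p.1 ∈ insert j (f.image Prod.fst) := fun p hp =>
      Finset.mem_insert_of_mem (Finset.mem_image_of_mem _ hp)
    obtain ⟨g, hg⟩ := hf.exists_equiv hM _ hfs (X · n) hn.2 (hrel _ _ hn)
    refine ⟨g.symm (X j n), hpart _ _ n hn ?_ g ?_⟩ <;> intro p hp <;>
      rcases Finset.mem_insert.1 hp with rfl | hp
    exacts [Finset.mem_insert_self _ _, hfs p hp, by simp, hg p hp]
  · by_cases hb : ∃ i, (i, b) ∈ f
    · obtain ⟨i, hi⟩ := hb
      exact ⟨i, by rwa [Finset.insert_eq_of_mem hi]⟩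
    let s := f.image Prod.fst
    choose idx hidx using hd
    -- By time `m` the tuple is settled and the enumeration `d` has listed `b` and the range of `f`.
    obtain ⟨m, hm, hmf, hmb⟩ := ((hset s).and (((eventually_all_finset f).2 fun p _ =>
      eventually_ge_atTop (idx p.2)).and (eventually_ge_atTop (idx b)))).exists
    obtain ⟨k, hk⟩ := hequiv s m hm (m + 1) (by omega)
    have hn : Settled s (m + 1) := ⟨fun i hi => (hm.1 i hi).trans (by omega), fun i hi j hj hij =>
      hm.2 hi hj (k.injective (by simpa only [hk i hi, hk j hj] using hij))⟩
    have hfs : ∀ p ∈ f, p.1 ∈ s := fun p hp => Finset.mem_image_of_mem _ hp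
    obtain ⟨g, hg⟩ := hf.exists_equiv hM s hfs (X · (m + 1)) hn.2 (hrel _ _ hn)
    -- At time `m + 1` each trajectory is at its position in `F m` or at the twin of it, so `g` can
    -- be altered off the range of `f` to put the image of `b` in `F (m + 1)`.
    obtain ⟨g', hg', hw⟩ := hFC.exists_witness m {a | ∃ p ∈ f, p.2 = a} g (by
      rintro _ ⟨p, hp, rfl⟩
      exact ⟨_, hmf p hp, hidx _⟩) (by
      rintro _ ⟨p, hp, rfl⟩
      refine ⟨X p.1 m, hFC.trajectory_mem _ (hm.1 _ (hfs p hp)), ?_⟩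
      rw [hg p hp]
      simp only [hX, trajectory_succ]
      split_ifs
      exacts [Or.inr rfl, Or.inl rfl])
    have hwb : g' b ∈ F (m + 1) := by
      have := hw _ hmb
      rwa [hidx] at this
    -- The integer part prescribes birth at time `m + 1` and position `g' b`.
    obtain ⟨j, hj, hjs⟩ := ((hω (Nat.pair (m + 1) (idx (g' b)))).and_eventually
      (eventually_gt_atTop (s.sup id))).exists
    have hbirth : birth (ω j) = m + 1 := by rw [birth, hj]; simp
    have hXj : X j (m + 1) = g' b := by
      have h1 := trajectory_birth (d := d) (F := F) (C := C) (q := q) (ω j) (by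
        rw [hbirth, hj]; simpa [hidx] using hwb)
      rw [hbirth, hj] at h1
      simpa [hidx] using h1
    have hg'' : ∀ p ∈ f, g' p.2 = X p.1 (m + 1) := fun p hp => by
      rw [hg' _ ⟨p, hp, rfl⟩, hg p hp]
    have hne : ∀ i ∈ s, X i (m + 1) ≠ X j (m + 1) := fun i hi he => by
      obtain ⟨p, hp, rfl⟩ := Finset.mem_image.1 hi
      rw [hXj, ← hg'' p hp] at he
      exact hb ⟨p.1, by rw [← g'.injective he]; exact hp⟩
    have hset' : Settled (insert j s) (m + 1) := by
      refine ⟨fun i hi => ?_, ?_⟩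
      · rcases Finset.mem_insert.1 hi with rfl | hi
        exacts [hbirth.le, hn.1 i hi]
      · intro i hi i' hi' he
        rcases Finset.mem_insert.1 (Finset.mem_coe.1 hi) with h1 | h1 <;>
          rcases Finset.mem_insert.1 (Finset.mem_coe.1 hi') with h2 | h2
        · rw [h1, h2]
        · exact absurd (h1 ▸ he.symm) (hne _ h2)
        · exact absurd (h2 ▸ he) (hne _ h1)
        · exact hn.2 h1 h2 he
    refine ⟨j, hpart _ _ _ hset' ?_ g' ?_⟩ <;> intro p hp <;>
      rcases Finset.mem_insert.1 hp with rfl | hp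
    exacts [Finset.mem_insert_self _ _, Finset.mem_insert_of_mem (hfs p hp), hXj.symm, hg'' p hp]

end IsSplittingSequence

end SplittingSequence

/-! ### Independent sampling and the invariant measure. -/

section Sampling

open MeasureTheory Filter ProbabilityTheory

variable {L : Language.{u, v}} {M : Type w} [L.Structure M]

/-- A sequence of reals that separates any two reals infinitely often. -/
theorem exists_seq_frequently_separating :
    ∃ q : ℕ → ℝ, ∀ a b : ℝ, a < b → ∃ᶠ n in atTop, a < q n ∧ q n ≤ b := by
  obtain ⟨e, he⟩ := exists_surjective_nat ℚ
  refine ⟨fun n => (e n.unpair.1 : ℝ), fun a b hab => frequently_atTop.2 fun N => ?_⟩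
  obtain ⟨r, h1, h2⟩ := exists_rat_btwn hab
  obtain ⟨k, rfl⟩ := he r
  -- Pairing with `N` makes every rational recur at arbitrarily late times.
  exact ⟨Nat.pair k N, Nat.right_le_pair k N, by simpa using h1, by simpa using h2.le⟩

theorem measurable_trajectory {_ : MeasurableSpace M} (d : ℕ → M)
    (F : ℕ → Finset M) (C : ℕ → M → M) (hC : ∀ n, Measurable (C n)) (q : ℕ → ℝ) (n : ℕ) :
    Measurable fun z => trajectory d F C q z n := by
  classical
  have hfloor : Measurable fun z : ℝ => ⌊z⌋₊ := Nat.measurable_floor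
  induction n with
  | zero =>
    let φ : ℕ → M := fun k => if d (Nat.unpair k).2 ∈ F (Nat.unpair k).1 then d (Nat.unpair k).2
      else d 0
    have : (fun z => trajectory d F C q z 0) = φ ∘ fun z => ⌊z⌋₊ := by
      ext z
      simp only [trajectory, birth, φ, Function.comp]
      congr
    rw [this]
    exact (measurable_from_top (f := φ)).comp hfloor
  | succ n ih =>
    simp_rw [trajectory_succ]
    refine Measurable.ite ?_ ((hC n).comp ih) ih
    refine MeasurableSet.inter ?_ measurableSet_Iio
    exact hfloor (MeasurableSet.of_discrete (s := {k : ℕ | (Nat.unpair k).1 ≤ n}))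

theorem measurable_eventualStructure [L.IsRelational] [Countable M] {Ω : Type*}
    [MeasurableSpace Ω] {mM : MeasurableSpace M} [DiscreteMeasurableSpace M]
    {X : Ω → ℕ → ℕ → M} (hX : ∀ i n, Measurable fun ω => X ω i n) :
    Measurable fun ω => eventualStructure L (X ω) := by
  refine measurable_generateFrom ?_
  rintro _ (⟨k, R, x, rfl⟩ | ⟨k, f, x, m, rfl⟩)
  · have : (fun ω => eventualStructure L (X ω)) ⁻¹' StructureSpace.relSet R x =
        ⋃ N : ℕ, ⋂ n ≥ N, {ω | Structure.RelMap R fun i => X ω (x i) n} := by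
      ext ω
      simp only [Set.mem_iUnion, Set.mem_iInter, Set.mem_ofPred_eq]
      exact eventually_atTop
    rw [this]
    refine .iUnion fun N => .iInter fun n => .iInter fun _ => ?_
    have hm : Measurable fun ω => fun i => X ω (x i) n := measurable_pi_lambda _ fun i => hX _ _
    exact hm (MeasurableSet.of_discrete (s := {y : Fin k → M | Structure.RelMap R y}))
  · exact isEmptyElim f

/-- Two coordinates have joint law `P.prod P`, for which the diagonal is null as `P` has no atoms.
-/
theorem ae_injective_infinitePi (P : Measure ℝ) [IsProbabilityMeasure P] [NullSingletonClass P] :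
    ∀ᵐ ω ∂(Measure.infinitePi fun _ : ℕ => P), Function.Injective ω := by
  have h : ∀ i j : ℕ, i ≠ j → ∀ᵐ ω ∂(Measure.infinitePi fun _ : ℕ => P), ω i ≠ ω j := by
    intro i j hij
    have h0 : (P.prod P) (Set.diagonal ℝ) = 0 := by
      rw [Measure.measure_prod_null measurableSet_diagonal]
      refine ae_of_all _ fun x => ?_
      have : Prod.mk x ⁻¹' Set.diagonal ℝ = {x} := by ext y; simp [eq_comm]
      exact (congrArg P this).trans (measure_singleton x)
    rw [← Measure.infinitePi_map_eval_prod (P := fun _ : ℕ => P) hij,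
      Measure.map_apply (by fun_prop) measurableSet_diagonal] at h0
    exact measure_eq_zero_iff_ae_notMem.1 h0
  have h' : ∀ᵐ ω ∂(Measure.infinitePi fun _ : ℕ => P), ∀ i j : ℕ, i ≠ j → ω i ≠ ω j := by
    refine ae_all_iff.2 fun i => ae_all_iff.2 fun j => ?_
    by_cases hij : i = j
    · simp [hij]
    · filter_upwards [h i j hij] with ω hω _ using hω
  filter_upwards [h'] with ω hω i j hij
  exact by_contra fun hne => hω i j hne hij

/-- The second Borel–Cantelli lemma for independent events of equal positive probability. -/
theorem ae_frequently_mem_infinitePi (P : Measure ℝ) [IsProbabilityMeasure P] {E : Set ℝ}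
    (hE : MeasurableSet E) (hP : P E ≠ 0) :
    ∀ᵐ ω ∂(Measure.infinitePi fun _ : ℕ => P), ∃ᶠ i in atTop, ω i ∈ E := by
  set μ := Measure.infinitePi fun _ : ℕ => P
  have hm : ∀ i : ℕ, MeasurableSet {ω : ℕ → ℝ | ω i ∈ E} := fun i => measurable_pi_apply i hE
  have hμ : ∀ i : ℕ, μ {ω : ℕ → ℝ | ω i ∈ E} = P E := fun i =>
    (measurePreserving_eval_infinitePi (fun _ : ℕ => P) i).measure_preimage hE.nullMeasurableSet
  have hind : iIndepSet (fun i => {ω : ℕ → ℝ | ω i ∈ E}) μ := by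
    rw [iIndepSet_iff_meas_biInter hm]
    intro s
    simp_rw [hμ]
    rw [← Measure.infinitePi_pi (fun _ : ℕ => P) (s := s) (t := fun _ => E) fun _ _ => hE]
    congr 1
    ext ω
    simp [Set.mem_pi]
  have h1 := measure_limsup_eq_one hm hind (by
    simp_rw [hμ]
    exact ENNReal.tsum_const_eq_top_of_ne_zero hP)
  have h2 := (prob_compl_eq_zero_iff (MeasurableSet.measurableSet_limsup hm)).2 h1
  filter_upwards [measure_eq_zero_iff_ae_notMem.1 h2] with ω hω
  rw [Set.notMem_compl_iff, mem_limsup_iff_frequently_mem] at hω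
  exact hω

theorem StructureSpace.measurable_smul [L.IsRelational] (g : _root_.Equiv.Perm ℕ) :
    Measurable fun N : StructureSpace L => g • N := by
  refine measurable_generateFrom ?_
  rintro _ (⟨k, R, x, rfl⟩ | ⟨k, f, x, m, rfl⟩)
  · exact MeasurableSpace.measurableSet_generateFrom (Or.inl ⟨k, R, g.symm ∘ x, rfl⟩)
  · exact isEmptyElim f

theorem HasTrivialClosure.admitsInvariantMeasure [L.IsRelational] [Countable L.Symbols]
    [Countable M] [Nonempty M] (hM : L.IsUltrahomogeneous M) (h : HasTrivialClosure L M) :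
    AdmitsInvariantMeasure L M := by
  obtain ⟨d, hd⟩ := exists_surjective_nat M
  obtain ⟨F, C, hFC⟩ := h.exists_isSplittingSequence d
  obtain ⟨q, hq⟩ := exists_seq_frequently_separating
  let _ : MeasurableSpace M := ⊤
  -- All that matters is that the law is atomless and gives each integer part positive probability.
  let P : Measure ℝ := gaussianReal 0 1
  have : NullSingletonClass P := nullSingletonClass_gaussianReal one_ne_zero
  let ν := Measure.infinitePi fun _ : ℕ => P
  let Φ : (ℕ → ℝ) → StructureSpace L :=
    fun ω => eventualStructure L fun i => trajectory d F C q (ω i)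
  have hΦ : Measurable Φ := measurable_eventualStructure fun i n =>
    (measurable_trajectory d F C (fun _ => measurable_from_top) q n).comp (measurable_pi_apply i)
  have hfloor : ∀ k : ℕ, P {z | ⌊z⌋₊ = k} ≠ 0 := fun k h0 => by
    have hsub : Set.Ioo (k : ℝ) (k + 1) ⊆ {z | ⌊z⌋₊ = k} := fun z hz =>
      (Nat.floor_eq_iff (k.cast_nonneg.trans hz.1.le)).2 ⟨hz.1.le, hz.2⟩
    have := gaussianReal_absolutelyContinuous' 0 one_ne_zero (measure_mono_null hsub h0)
    simp at this
  have hback : ∀ᵐ ω ∂ν, Φ ω ∈ StructureSpace.isoClass L M := by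
    have hfreq : ∀ᵐ ω ∂ν, ∀ k : ℕ, ∃ᶠ i in atTop, ⌊ω i⌋₊ = k := ae_all_iff.2 fun k =>
      ae_frequently_mem_infinitePi P (E := {z | ⌊z⌋₊ = k})
        (Nat.measurable_floor (measurableSet_singleton k)) (hfloor k)
    filter_upwards [ae_injective_infinitePi P, hfreq] with ω h1 h2
    exact (hFC.backAndForth_eventualStructure hM hd hq h1 h2).mem_isoClass
  refine ⟨ν.map Φ, Measure.isProbabilityMeasure_map hΦ.aemeasurable, ⟨fun g A hA => ?_⟩,
    measurableSet_isoClass hM, ?_⟩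
  · have hperm : ν.map (fun ω i => ω (g.symm i)) = ν :=
      Measure.map_infinitePi_infinitePi_of_inj (P := fun _ : ℕ => P) g.symm.injective
    have hperm_meas : Measurable fun (ω : ℕ → ℝ) i => ω (g.symm i) := by fun_prop
    -- Relabelling the structure permutes the samples, which leaves the product measure unchanged.
    have hsmul : ∀ ω, g • Φ ω = Φ fun i => ω (g.symm i) := fun ω => by
      refine Structure.ext ?_ rfl
      funext n f
      exact isEmptyElim f
    have hset : Φ ⁻¹' ((fun N => g • N) ⁻¹' A) = (fun ω i => ω (g.symm i)) ⁻¹' (Φ ⁻¹' A) := by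
      ext ω
      simp only [Set.mem_preimage, hsmul]
    have hsmul_meas : MeasurableSet ((fun N : StructureSpace L => g • N) ⁻¹' A) :=
      StructureSpace.measurable_smul g hA
    rw [Measure.map_apply hΦ hsmul_meas, hset, Measure.map_apply hΦ hA,
      ← Measure.map_apply hperm_meas (hΦ hA), hperm]
  · rw [Measure.map_apply hΦ (measurableSet_isoClass hM)]
    exact prob_compl_eq_zero_iff (hΦ (measurableSet_isoClass hM)) |>.1 hback

end Sampling

end FirstOrder.Language

theorem corollary1p2 (L : FirstOrder.Language.{u, v}) [L.IsRelational]
    [Countable L.Symbols] (M : Type w) [L.Structure M] [Countable M] [Infinite M]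
    (hM : L.IsUltrahomogeneous M) :
    FirstOrder.Language.AdmitsInvariantMeasure L M ↔
      FirstOrder.Language.StrongAmalgamation (L.age M) := by
  refine ⟨fun h => ?_, fun h => (h.hasTrivialClosure hM).admitsInvariantMeasure hM⟩
  exact FirstOrder.Language.strongAmalgamation_of_exists_equiv hM (h.exists_equiv hM)
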